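/- Let $d,k\ge 1$ be integers. For $V\subseteq\mathbb R^d$ and $r\ge 0$ let $G_r(V)$ be the graph with vertex set $V$ in which two distinct points are adjacent if and only if their Euclidean distance is at most $r$, and let $N_{k,r}(V)$ be the maximum number of vertices of $G_r(V)$ that can be properly coloured with $k$ colours. For $\lambda>0$ let $\mathcal X_\lambda$ be a homogeneous Poisson point process of intensity $\lambda$ in $\mathbb R^d$, put $F_{k,\lambda}(t)=N_{k,1}([0,t]^d\cap\mathcal X_\lambda)$, and let $$a_{k,\lambda}=\inf_{t>0}\frac{\mathbb E\,[F_{k,\lambda}(t)]}{\lambda t^d}.$$ Then for all $\lambda>0$ and $\epsilon>0$, $$a_{k,\lambda(1+\epsilon)}\le a_{k,\lambda}+\epsilon,$$ and for all $\lambda>0$ and $0<\epsilon<1$, $$a_{k,\lambda(1-\epsilon)}\ge a_{k,\lambda}-\frac{\epsilon}{1-\epsilon}.$$ -/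

import Mathlib

open MeasureTheory ProbabilityTheory
open scoped ENNReal

/-- The random geometric graph `G_r(V)`: the vertices are the points of `V`, and two distinct
points are adjacent when their Euclidean distance is at most `r`. -/
def geomGraph {d : ℕ} (r : ℝ) (V : Set (EuclideanSpace ℝ (Fin d))) : SimpleGraph V where
  Adj u v := u ≠ v ∧ dist u v ≤ r
  symm := ⟨fun u v h => ⟨h.1.symm, by rw [dist_comm]; exact h.2⟩⟩
  loopless := ⟨fun _ h => h.1 rfl⟩

/-- `N_{k,r}(V)`: the maximum number of vertices of `G_r(V)` that can be properly coloured with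
`k` colours, i.e. the largest size of a set of vertices whose induced subgraph is `k`-colourable. -/
noncomputable def maxColored {d : ℕ} (k : ℕ) (r : ℝ) (V : Set (EuclideanSpace ℝ (Fin d))) : ℕ∞ :=
  ⨆ (S : Set V) (_ : ((geomGraph r V).induce S).Colorable k), S.encard

/-- The random set `X` (a map from a probability space to subsets of `ℝ^d`) is a homogeneous Poisson
point process of intensity `lam` in `ℝ^d`. -/
structure IsPoissonPointProcess {d : ℕ} {Ω : Type*} [MeasurableSpace Ω] (P : Measure Ω)
    (X : Ω → Set (EuclideanSpace ℝ (Fin d))) (lam : ℝ) : Prop where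
  /-- Every realisation is locally finite. -/
  finite_inter : ∀ ω, ∀ B, Bornology.IsBounded B → (X ω ∩ B).Finite
  /-- The number of points in a bounded Borel set is a random variable. -/
  measurable_count : ∀ B, MeasurableSet B → Bornology.IsBounded B →
    Measurable fun ω => (X ω ∩ B).ncard
  /-- The number of points in a bounded Borel set `B` is Poisson with mean `lam * vol(B)`. -/
  map_count : ∀ B, MeasurableSet B → Bornology.IsBounded B →
    P.map (fun ω => (X ω ∩ B).ncard) = poissonMeasure (lam * volume.real B).toNNReal
  /-- The numbers of points in pairwise disjoint bounded Borel sets are independent. -/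
  indep_count : ∀ (n : ℕ) (B : Fin n → Set (EuclideanSpace ℝ (Fin d))),
    (∀ i, MeasurableSet (B i)) → (∀ i, Bornology.IsBounded (B i)) →
    Pairwise (fun i j => Disjoint (B i) (B j)) →
    iIndepFun (fun i ω => (X ω ∩ B i).ncard) P

/-- The cube `[0,t]^d`. -/
def cube (d : ℕ) (t : ℝ) : Set (EuclideanSpace ℝ (Fin d)) := {x | ∀ i, 0 ≤ x i ∧ x i ≤ t}

/-- `F_{k,λ}(t) = N_{k,1}([0,t]^d ∩ X_λ)`, for a realisation `X ω` of the process. -/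
noncomputable def coloredCount {d : ℕ} {Ω : Type*} (k : ℕ)
    (X : Ω → Set (EuclideanSpace ℝ (Fin d))) (t : ℝ) (ω : Ω) : ℕ∞ :=
  maxColored k 1 (cube d t ∩ X ω)

/-- The expected colouring ratio `E[F_{k,λ}(t)] / (λ t^d)`. -/
noncomputable def meanColoringRatio {d : ℕ} {Ω : Type*} [MeasurableSpace Ω] (k : ℕ) (lam : ℝ)
    (P : Measure Ω) (X : Ω → Set (EuclideanSpace ℝ (Fin d))) (t : ℝ) : ℝ≥0∞ :=
  (∫⁻ ω, (coloredCount k X t ω : ℝ≥0∞) ∂P) / ENNReal.ofReal (lam * t ^ d)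

/-- The constant `a_{k,λ}`, the infimum over `t > 0` of the expected colouring ratio, for a
Poisson point process `X` of intensity `λ`. The ratio is at most `1`, so the infimum is finite. -/
noncomputable def coloringConstant {d : ℕ} {Ω : Type*} [MeasurableSpace Ω] (k : ℕ) (lam : ℝ)
    (P : Measure Ω) (X : Ω → Set (EuclideanSpace ℝ (Fin d))) : ℝ :=
  (⨅ (t : ℝ) (_ : 0 < t), meanColoringRatio k lam P X t).toReal

open Filter Topology

/-! Adding one point raises the number of `k`-colourable vertices by at most one, so raising the
intensity by `s` should raise the mean over a set `A` by at most `s * vol(A)`. The usual proof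
superposes an independent process. Here the two processes live on unrelated spaces, so only laws of
cell counts are compared.

Cut `A` into small disjoint cells. The counts are independent Poisson variables, and Poisson(r + s)
is the convolution of Poisson(r) and Poisson(s), which gives the coupling at the level of counts
(`lintegral_pi_poissonMeasure_add_le`). The discrete functional `maxColoredCells` never exceeds the
true one and attains it on fine partitions; Fatou's lemma removes the discretisation. With `s = lam
* ε` and `A` a cube, division by `lam * t ^ d` leaves an excess of `ε`. -/

/-- The mean of the Poisson distribution, as a lower Lebesgue integral. -/
theorem lintegral_natCast_poissonMeasure (r : NNReal) :
    ∫⁻ n, (n : ℝ≥0∞) ∂(poissonMeasure r) = r := by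
  have htot : ∑' n : ℕ, ENNReal.ofReal (Real.exp (-r) * r ^ n / n.factorial) = 1 := by
    have h := lintegral_one (μ := poissonMeasure r)
    rw [measure_univ, poissonMeasure, lintegral_sum_measure] at h
    simpa using h
  rw [poissonMeasure, lintegral_sum_measure]
  simp only [lintegral_smul_measure, lintegral_dirac, smul_eq_mul]
  rw [tsum_eq_zero_add' ENNReal.summable]
  simp only [Nat.cast_zero, mul_zero, zero_add]
  have hstep (n : ℕ) :
      ENNReal.ofReal (Real.exp (-r) * r ^ (n + 1) / (n + 1).factorial) * ((n + 1 : ℕ) : ℝ≥0∞)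
        = r * ENNReal.ofReal (Real.exp (-r) * r ^ n / n.factorial) := by
    rw [← ENNReal.ofReal_natCast, ← ENNReal.ofReal_mul (by positivity),
      ← ENNReal.ofReal_coe_nnreal, ← ENNReal.ofReal_mul (by positivity)]
    congr 1
    have : (n.factorial : ℝ) ≠ 0 := by positivity
    rw [Nat.factorial_succ]
    push_cast
    field_simp
    ring
  simp only [hstep]
  rw [ENNReal.tsum_mul_left, htot, mul_one]

/-- If `f` grows by at most the total increment, then its mean under a product of Poisson
distributions grows by at most the increment of the rates. -/
theorem lintegral_pi_poissonMeasure_add_le {ι : Type*} [Fintype ι] (f : (ι → ℕ) → ℝ≥0∞)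
    (hf : ∀ a b, f (a + b) ≤ f a + ∑ i, (b i : ℝ≥0∞)) (r s : ι → NNReal) :
    ∫⁻ c, f c ∂(Measure.pi fun i => poissonMeasure (r i + s i)) ≤
      ∫⁻ c, f c ∂(Measure.pi fun i => poissonMeasure (r i)) + ∑ i, (s i : ℝ≥0∞) := by
  have hmeas {g : (ι → ℕ) → ℝ≥0∞} : Measurable g := measurable_of_countable g
  let Q : Measure (ι → ℕ × ℕ) :=
    Measure.pi fun i => (poissonMeasure (r i)).prod (poissonMeasure (s i))
  have hadd : Q.map (fun p i => (p i).1 + (p i).2) =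
      Measure.pi fun i => poissonMeasure (r i + s i) := by
    have (i : ι) : ((poissonMeasure (r i)).prod (poissonMeasure (s i))).map
        (fun p : ℕ × ℕ => p.1 + p.2) = poissonMeasure (r i + s i) := by
      rw [← poissonMeasure_conv_poissonMeasure]; rfl
    have inst (i : ι) : SigmaFinite (((poissonMeasure (r i)).prod (poissonMeasure (s i))).map
        (fun p : ℕ × ℕ => p.1 + p.2)) := by rw [this]; infer_instance
    rw [Measure.pi_map_pi (f := fun _ (p : ℕ × ℕ) => p.1 + p.2) (fun i => by fun_prop)]
    simp only [this]
  have hfst : Q.map (fun p i => (p i).1) = Measure.pi fun i => poissonMeasure (r i) := by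
    have (i : ι) : ((poissonMeasure (r i)).prod (poissonMeasure (s i))).map
        (fun p : ℕ × ℕ => p.1) = poissonMeasure (r i) := by
      simp
    have inst (i : ι) : SigmaFinite (((poissonMeasure (r i)).prod (poissonMeasure (s i))).map
        (fun p : ℕ × ℕ => p.1)) := by rw [this]; infer_instance
    rw [Measure.pi_map_pi (f := fun _ (p : ℕ × ℕ) => p.1) (fun i => by fun_prop)]
    simp only [this]
  have hsnd (i : ι) : ∫⁻ p, ((p i).2 : ℝ≥0∞) ∂Q = s i := by
    have h1 := (measurePreserving_eval
      (fun i => (poissonMeasure (r i)).prod (poissonMeasure (s i))) i).lintegral_comp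
      (f := fun p : ℕ × ℕ => (p.2 : ℝ≥0∞)) (measurable_of_countable _)
    have h2 := (measurePreserving_snd (μ := poissonMeasure (r i))
      (ν := poissonMeasure (s i))).lintegral_comp
      (f := fun n : ℕ => (n : ℝ≥0∞)) (measurable_of_countable _)
    rw [lintegral_natCast_poissonMeasure] at h2
    rw [← h2, ← h1]
  rw [← hadd, ← hfst, lintegral_map hmeas (by fun_prop), lintegral_map hmeas (by fun_prop)]
  calc ∫⁻ p, f (fun i => (p i).1 + (p i).2) ∂Q
      ≤ ∫⁻ p, f (fun i => (p i).1) + ∑ i, ((p i).2 : ℝ≥0∞) ∂Q :=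
        lintegral_mono fun p => hf (fun i => (p i).1) fun i => (p i).2
    _ = _ := by
        rw [lintegral_add_left (measurable_of_countable _),
          lintegral_finsetSum _ (fun i _ => measurable_of_countable _)]
        simp only [hsnd]

/-! ### Discretisation of the colouring number by cells -/

/-- A bounded measurable set has finite measurable partitions with arbitrarily small cells. -/
theorem exists_measurable_partition_dist_lt {E : Type*} [PseudoMetricSpace E] [ProperSpace E]
    [MeasurableSpace E] [OpensMeasurableSpace E] {A : Set E} (hA : MeasurableSet A)
    (hb : Bornology.IsBounded A) {δ : ℝ} (hδ : 0 < δ) :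
    ∃ (N : ℕ) (B : Fin N → Set E), (∀ i, MeasurableSet (B i)) ∧
      Pairwise (fun i j => Disjoint (B i) (B j)) ∧ (⋃ i, B i) = A ∧
      ∀ i, ∀ x ∈ B i, ∀ y ∈ B i, dist x y < δ := by
  obtain ⟨t, -, ht, hcov⟩ := exists_finite_cover_balls_of_isCompact_closure
    hb.isCompact_closure (half_pos hδ)
  obtain ⟨N, e, he⟩ := ht.fin_embedding
  let U : Fin N → Set E := fun i => A ∩ Metric.ball (e i) (δ / 2)
  have hU (i : Fin N) : MeasurableSet (U i) := hA.inter Metric.isOpen_ball.measurableSet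
  refine ⟨N, disjointed U, fun i => disjointedRec (fun _ _ h => h.diff (hU _)) (hU i),
    disjoint_disjointed U, ?_, fun i x hx y hy => ?_⟩
  · rw [iUnion_disjointed, ← Set.inter_iUnion, Set.inter_eq_left]
    refine hcov.trans fun x hx => ?_
    simp only [Set.mem_iUnion] at hx ⊢
    obtain ⟨y, hy, hxy⟩ := hx
    rw [← he] at hy
    obtain ⟨i, rfl⟩ := hy
    exact ⟨i, hxy⟩
  · have h1 := (disjointed_subset U i hx).2
    have h2 := (disjointed_subset U i hy).2
    rw [Metric.mem_ball] at h1 h2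
    linarith [dist_triangle_right x y (e i)]

section Cells

variable {d : ℕ} {ι : Type*}

/-- The graph on the cells `B i` in which two cells are adjacent when they contain points at
distance at most `r`. -/
def cellGraph (r : ℝ) (B : ι → Set (EuclideanSpace ℝ (Fin d))) : SimpleGraph ι where
  Adj i j := i ≠ j ∧ ∃ x ∈ B i, ∃ y ∈ B j, dist x y ≤ r
  symm := ⟨fun _ _ ⟨h, x, hx, y, hy, hxy⟩ => ⟨h.symm, y, hy, x, hx, by rwa [dist_comm]⟩⟩
  loopless := ⟨fun _ h => h.1 rfl⟩

/-- The largest number of cells with a nonzero count that can be properly `k`-coloured in the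
cell graph. -/
noncomputable def maxColoredCells (k : ℕ) (r : ℝ) (B : ι → Set (EuclideanSpace ℝ (Fin d)))
    (c : ι → ℕ) : ℕ∞ :=
  ⨆ (S : Set ι) (_ : (∀ i ∈ S, c i ≠ 0) ∧ ((cellGraph r B).induce S).Colorable k), S.encard

/-- Discard from a colourable set of cells those that are empty under `a`. Each discarded cell has
`b i ≥ 1`, so their number is at most the total of `b`. -/
theorem maxColoredCells_add_le [Fintype ι] (k : ℕ) (r : ℝ)
    (B : ι → Set (EuclideanSpace ℝ (Fin d))) (a b : ι → ℕ) :
    maxColoredCells k r B (a + b) ≤ maxColoredCells k r B a + ∑ i, (b i : ℕ∞) := by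
  classical
  refine iSup₂_le fun S ⟨hS, hcol⟩ => ?_
  let T : Set ι := {i ∈ S | a i ≠ 0}
  have hTS : T ⊆ S := fun i hi => hi.1
  have hT : T.encard ≤ maxColoredCells k r B a :=
    le_iSup₂_of_le T ⟨fun i hi => hi.2,
      hcol.of_hom (SimpleGraph.induceHomOfLE _ hTS).toHom⟩ le_rfl
  have hdiff : (S \ T).encard ≤ ∑ i, (b i : ℕ∞) := by
    rw [← Set.coe_toFinset (S \ T), Set.encard_coe_eq_coe_finsetCard]
    rw [← Nat.cast_sum, Nat.cast_le, Finset.card_eq_sum_ones]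
    refine (Finset.sum_le_sum fun i hi => ?_).trans
      (Finset.sum_le_sum_of_subset (Finset.subset_univ _))
    rw [Set.mem_toFinset] at hi
    have h1 := hS i hi.1
    have h2 : a i = 0 := by
      by_contra h
      exact hi.2 ⟨hi.1, h⟩
    simp only [Pi.add_apply, h2, zero_add] at h1
    omega
  calc S.encard = (S \ T).encard + T.encard := (Set.encard_sdiff_add_encard_of_subset hTS).symm
    _ ≤ _ := by rw [add_comm]; exact add_le_add hT hdiff

/-- Choose one point of `V` in each selected cell. Adjacent points lie in adjacent cells, so a
colouring of the cells colours the points. -/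
theorem maxColoredCells_le_maxColored (k : ℕ) (r : ℝ) (B : ι → Set (EuclideanSpace ℝ (Fin d)))
    (hB : Pairwise fun i j => Disjoint (B i) (B j)) (V : Set (EuclideanSpace ℝ (Fin d))) :
    maxColoredCells k r B (fun i => (V ∩ B i).ncard) ≤ maxColored k r V := by
  refine iSup₂_le fun S ⟨hS, hcol⟩ => ?_
  have hne (i : S) : ∃ x : V, (x : EuclideanSpace ℝ (Fin d)) ∈ B i := by
    obtain ⟨x, hx⟩ := Set.nonempty_of_ncard_ne_zero (hS i i.2)
    exact ⟨⟨x, hx.1⟩, hx.2⟩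
  choose x hx using hne
  have hcell (i j : S) (h : (x i : EuclideanSpace ℝ (Fin d)) ∈ B j) : i = j := by
    by_contra hij
    exact Set.disjoint_left.1 (hB fun h => hij (Subtype.ext h)) (hx i) h
  have hinj : Function.Injective x := fun i j h => hcell i j (h ▸ hx j)
  refine le_iSup₂_of_le (Set.range x) ?_ ?_
  · obtain ⟨C⟩ := hcol
    have hmem (v : Set.range x) : ∃ i, x i = v := v.2
    choose g hg using hmem
    refine ⟨SimpleGraph.Coloring.mk (fun v => C (g v)) fun {u v} huv => C.valid ?_⟩
    have h2 : dist (x (g u) : EuclideanSpace ℝ (Fin d)) (x (g v)) ≤ r := by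
      rw [hg, hg]; exact huv.2
    refine ⟨fun h => huv.1 ?_, _, hx _, _, hx _, h2⟩
    exact (hg u).symm.trans ((congrArg x (Subtype.ext h)).trans (hg v))
  · rw [← Set.image_univ, hinj.encard_image, Set.encard_univ]
    rfl

/-- Once `δ` is below every gap in the finite set `V`, each cell holds at most one point. Once `2 *
δ` is below every excess of a distance over `r`, adjacent occupied cells hold adjacent points: each
endpoint moves by less than `δ` within its cell. -/
theorem eventually_maxColored_le_maxColoredCells (k : ℕ) (r : ℝ)
    {V : Set (EuclideanSpace ℝ (Fin d))} (hV : V.Finite) :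
    ∀ᶠ δ in 𝓝[>] (0 : ℝ), ∀ (N : ℕ) (B : Fin N → Set (EuclideanSpace ℝ (Fin d))),
      V ⊆ ⋃ i, B i → (∀ i, ∀ x ∈ B i, ∀ y ∈ B i, dist x y < δ) →
      maxColored k r V ≤ maxColoredCells k r B (fun i => (V ∩ B i).ncard) := by
  have hsep : ∀ᶠ δ in 𝓝[>] (0 : ℝ), ∀ p ∈ V ×ˢ V,
      (p.1 ≠ p.2 → δ < dist p.1 p.2) ∧ (r < dist p.1 p.2 → r + 2 * δ < dist p.1 p.2) := by
    rw [eventually_all_finite (hV.prod hV)]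
    rintro ⟨x, y⟩ -
    refine Eventually.and ?_ ?_
    · by_cases h : x = y
      · simp [h]
      · filter_upwards [nhdsWithin_le_nhds (gt_mem_nhds (dist_pos.2 h))] with δ hδ _ using hδ
    · by_cases h : r < dist x y
      · have hpos : 0 < (dist x y - r) / 2 := by linarith
        filter_upwards [nhdsWithin_le_nhds (gt_mem_nhds hpos)] with δ hδ _
        linarith
      · simp [h]
  filter_upwards [hsep] with δ hδ N B hcov hdiam
  have hmem (v : V) : ∃ i, (v : EuclideanSpace ℝ (Fin d)) ∈ B i := Set.mem_iUnion.1 (hcov v.2)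
  choose g hg using hmem
  have hinj : Function.Injective g := fun u v h => by
    by_contra huv
    have h1 := (hδ (u, v) ⟨u.2, v.2⟩).1 fun h => huv (Subtype.ext h)
    exact lt_asymm h1 (hdiam _ _ (hg u) _ (h ▸ hg v))
  refine iSup₂_le fun S ⟨C⟩ => le_iSup₂_of_le (g '' S) ⟨?_, ?_⟩ (hinj.encard_image S).ge
  · rintro _ ⟨v, -, rfl⟩
    exact ((Set.ncard_pos (hV.inter_of_left _)).2 ⟨v, v.2, hg v⟩).ne'
  · have hpre (i : g '' S) : ∃ v : S, g v = i := by
      obtain ⟨_, v, hv, rfl⟩ := i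
      exact ⟨⟨v, hv⟩, rfl⟩
    choose h hh using hpre
    refine ⟨SimpleGraph.Coloring.mk (fun i => C (h i)) fun {i j} hij => C.valid ?_⟩
    obtain ⟨hne, x, hx, y, hy, hxy⟩ := hij
    refine ⟨fun e => hne ?_, ?_⟩
    · exact (hh i).symm.trans ((congrArg g e).trans (hh j))
    · by_contra hgt
      have h1 := (hδ (h i, h j) ⟨(h i).1.2, (h j).1.2⟩).2 (not_le.1 hgt)
      have h2 := hdiam _ _ ((hh i) ▸ hg (h i)) x hx
      have h3 := hdiam _ _ ((hh j) ▸ hg (h j)) y hy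
      have h4 := dist_triangle4 ((h i : V) : EuclideanSpace ℝ (Fin d)) x y (h j : V)
      rw [dist_comm y] at h4
      simp only at h1
      linarith

end Cells

theorem maxColored_le_ncard {d : ℕ} (k : ℕ) (r : ℝ) {V : Set (EuclideanSpace ℝ (Fin d))}
    (hV : V.Finite) : maxColored k r V ≤ V.ncard := by
  rw [hV.cast_ncard_eq]
  refine iSup₂_le fun S _ => (Set.encard_le_encard (Set.subset_univ S)).trans ?_
  rw [Set.encard_univ]
  rfl

/-! ### Mean colouring number of a Poisson process -/

namespace IsPoissonPointProcess

variable {d : ℕ} {Ω : Type*} [MeasurableSpace Ω] {P : Measure Ω}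
  {X : Ω → Set (EuclideanSpace ℝ (Fin d))} {lam : ℝ}

theorem map_counts [IsProbabilityMeasure P] (hX : IsPoissonPointProcess P X lam) {N : ℕ}
    {B : Fin N → Set (EuclideanSpace ℝ (Fin d))} (hB : ∀ i, MeasurableSet (B i))
    (hb : ∀ i, Bornology.IsBounded (B i)) (hd : Pairwise fun i j => Disjoint (B i) (B j)) :
    P.map (fun ω i => (X ω ∩ B i).ncard) =
      Measure.pi fun i => poissonMeasure (lam * volume.real (B i)).toNNReal := by
  rw [(iIndepFun_iff_map_fun_eq_pi_map
    fun i => (hX.measurable_count _ (hB i) (hb i)).aemeasurable).1 (hX.indep_count N B hB hb hd)]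
  simp only [hX.map_count _ (hB _) (hb _)]

theorem lintegral_maxColored_le_mul_volume (hX : IsPoissonPointProcess P X lam) (k : ℕ) (r : ℝ)
    {A : Set (EuclideanSpace ℝ (Fin d))} (hA : MeasurableSet A) (hb : Bornology.IsBounded A) :
    ∫⁻ ω, (maxColored k r (A ∩ X ω) : ℝ≥0∞) ∂P ≤ ENNReal.ofReal (lam * volume.real A) := by
  calc ∫⁻ ω, (maxColored k r (A ∩ X ω) : ℝ≥0∞) ∂P
      ≤ ∫⁻ ω, ((X ω ∩ A).ncard : ℝ≥0∞) ∂P := lintegral_mono fun ω => by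
        rw [Set.inter_comm]
        simpa using ENat.toENNReal_le.2 (maxColored_le_ncard k r (hX.finite_inter ω A hb))
    _ = ENNReal.ofReal (lam * volume.real A) := by
        rw [← lintegral_map (f := fun n : ℕ => (n : ℝ≥0∞)) (measurable_of_countable _)
          (hX.measurable_count A hA hb), hX.map_count A hA hb, lintegral_natCast_poissonMeasure]
        rfl

/-- Raising the intensity by `s` raises the mean of `N_{k,r}` on `A` by at most `s * vol(A)`. -/
theorem lintegral_maxColored_le_add [IsProbabilityMeasure P] {Ω' : Type*}
    [MeasurableSpace Ω'] {P' : Measure Ω'} [IsProbabilityMeasure P'] {Y : Ω' → Set (EuclideanSpace ℝ (Fin d))} {s : ℝ}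
    (hlam : 0 ≤ lam) (hs : 0 ≤ s) (hX : IsPoissonPointProcess P X lam)
    (hY : IsPoissonPointProcess P' Y (lam + s)) (k : ℕ) (r : ℝ)
    {A : Set (EuclideanSpace ℝ (Fin d))} (hA : MeasurableSet A) (hb : Bornology.IsBounded A) :
    ∫⁻ ω, (maxColored k r (A ∩ Y ω) : ℝ≥0∞) ∂P' ≤
      ∫⁻ ω, (maxColored k r (A ∩ X ω) : ℝ≥0∞) ∂P + ENNReal.ofReal (s * volume.real A) := by
  choose N B hB hdisj hcov hdiam using fun n : ℕ =>
    exists_measurable_partition_dist_lt hA hb (δ := 1 / ((n : ℝ) + 1)) (by positivity)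
  have hsub (n i) : B n i ⊆ A := hcov n ▸ Set.subset_iUnion (B n) i
  have hbB (n i) : Bornology.IsBounded (B n i) := hb.subset (hsub n i)
  have hinter (V : Set (EuclideanSpace ℝ (Fin d))) (n i) :
      (A ∩ V) ∩ B n i = V ∩ B n i := by
    rw [Set.inter_comm A, Set.inter_assoc, Set.inter_eq_right.2 (hsub n i)]
  let f (n : ℕ) (c : Fin (N n) → ℕ) : ℝ≥0∞ := (maxColoredCells k r (B n) c : ℝ≥0∞)
  have hf (n : ℕ) : Measurable (f n) := measurable_of_countable _
  have hcX (n : ℕ) : Measurable fun ω i => (X ω ∩ B n i).ncard :=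
    measurable_pi_lambda _ fun i => hX.measurable_count _ (hB n i) (hbB n i)
  have hcY (n : ℕ) : Measurable fun ω i => (Y ω ∩ B n i).ncard :=
    measurable_pi_lambda _ fun i => hY.measurable_count _ (hB n i) (hbB n i)
  have hle (n : ℕ) : ∫⁻ ω, f n (fun i => (Y ω ∩ B n i).ncard) ∂P' ≤
      ∫⁻ ω, (maxColored k r (A ∩ X ω) : ℝ≥0∞) ∂P + ENNReal.ofReal (s * volume.real A) := by
    have hvol : ∑ i, ((s * volume.real (B n i)).toNNReal : ℝ≥0∞) =
        ENNReal.ofReal (s * volume.real A) := by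
      rw [← hcov n, measureReal_iUnion_fintype (hdisj n) (hB n)
        fun i => (hbB n i).measure_lt_top.ne, Finset.mul_sum,
        ENNReal.ofReal_sum_of_nonneg fun i _ => by positivity]
      rfl
    calc ∫⁻ ω, f n (fun i => (Y ω ∩ B n i).ncard) ∂P'
        = ∫⁻ c, f n c ∂(Measure.pi fun i => poissonMeasure
            ((lam * volume.real (B n i)).toNNReal + (s * volume.real (B n i)).toNNReal)) := by
          rw [← lintegral_map (hf n) (hcY n), hY.map_counts (hB n) (hbB n) (hdisj n)]
          simp only [add_mul]
          congr! 4 with i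
          exact Real.toNNReal_add (by positivity) (by positivity)
      _ ≤ ∫⁻ c, f n c ∂(Measure.pi fun i => poissonMeasure (lam * volume.real (B n i)).toNNReal)
            + ∑ i, ((s * volume.real (B n i)).toNNReal : ℝ≥0∞) := by
          refine lintegral_pi_poissonMeasure_add_le (f n) (fun a b => ?_) _ _
          have := ENat.toENNReal_le.2 (maxColoredCells_add_le k r (B n) a b)
          rw [← Nat.cast_sum] at this ⊢
          simpa only [f, ENat.toENNReal_add, ENat.toENNReal_coe] using this
      _ = ∫⁻ ω, f n (fun i => (X ω ∩ B n i).ncard) ∂P + ENNReal.ofReal (s * volume.real A) := by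
          rw [hvol, ← hX.map_counts (hB n) (hbB n) (hdisj n), lintegral_map (hf n) (hcX n)]
      _ ≤ _ := by
          gcongr with ω
          have := maxColoredCells_le_maxColored k r (B n) (hdisj n) (A ∩ X ω)
          simp only [hinter] at this
          exact ENat.toENNReal_le.2 this
  -- The required fineness depends on `ω`, so the discrete bound is only eventual at each `ω`;
  -- Fatou's lemma needs no more. Only the discrete functionals have to be measurable.
  calc ∫⁻ ω, (maxColored k r (A ∩ Y ω) : ℝ≥0∞) ∂P'
      ≤ ∫⁻ ω, liminf (fun n => f n (fun i => (Y ω ∩ B n i).ncard)) atTop ∂P' := by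
        refine lintegral_mono fun ω => le_liminf_of_le (by isBoundedDefault) ?_
        have hfin : (A ∩ Y ω).Finite := Set.inter_comm A _ ▸ hY.finite_inter ω A hb
        have hlim : Tendsto (fun n : ℕ => 1 / ((n : ℝ) + 1)) atTop (𝓝[>] 0) :=
          tendsto_nhdsWithin_iff.2 ⟨tendsto_one_div_add_atTop_nhds_zero_nat,
            Eventually.of_forall fun n => Set.mem_Ioi.2 (by positivity)⟩
        filter_upwards [hlim.eventually (eventually_maxColored_le_maxColoredCells k r hfin)]
          with n hn
        have := hn (N n) (B n) (by rw [hcov]; exact Set.inter_subset_left) (hdiam n)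
        simp only [hinter] at this
        exact ENat.toENNReal_le.2 this
    _ ≤ liminf (fun n => ∫⁻ ω, f n (fun i => (Y ω ∩ B n i).ncard) ∂P') atTop :=
        lintegral_liminf_le fun n => (hf n).comp (hcY n)
    _ ≤ _ := liminf_le_of_le (by isBoundedDefault) fun b hb => by
        obtain ⟨n, hn⟩ := hb.exists
        exact hn.trans (hle n)

end IsPoissonPointProcess

/-! ### Cubes and the colouring constant -/

section Cube

variable {d : ℕ}

theorem cube_eq_preimage (d : ℕ) (t : ℝ) :
    cube d t = WithLp.ofLp ⁻¹' Set.Icc (fun _ : Fin d => (0 : ℝ)) (fun _ => t) := by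
  ext x
  simp [cube, Pi.le_def, forall_and]

theorem measurableSet_cube (d : ℕ) (t : ℝ) : MeasurableSet (cube d t) := by
  rw [cube_eq_preimage]
  exact (PiLp.volume_preserving_ofLp (Fin d)).measurable measurableSet_Icc

theorem isBounded_cube (d : ℕ) (t : ℝ) : Bornology.IsBounded (cube d t) := by
  rw [cube_eq_preimage]
  exact (PiLp.antilipschitzWith_ofLp 2 _).isBounded_preimage (Metric.isBounded_Icc _ _)

theorem volume_real_cube (d : ℕ) {t : ℝ} (ht : 0 ≤ t) : volume.real (cube d t) = t ^ d := by
  rw [cube_eq_preimage, measureReal_def, (PiLp.volume_preserving_ofLp (Fin d)).measure_preimage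
    measurableSet_Icc.nullMeasurableSet, Real.volume_Icc_pi]
  simp [ht]

end Cube

/-- Raising the intensity by the factor `1 + ε` raises the colouring constant by at most `ε`. -/
theorem coloringConstant_le_add {d k : ℕ} {lam ε : ℝ} (hlam : 0 < lam) (hε : 0 < ε)
    {Ω : Type*} [MeasurableSpace Ω] {P : Measure Ω} [IsProbabilityMeasure P]
    {X : Ω → Set (EuclideanSpace ℝ (Fin d))} (hX : IsPoissonPointProcess P X lam)
    {Ω' : Type*} [MeasurableSpace Ω'] {P' : Measure Ω'} [IsProbabilityMeasure P']
    {Y : Ω' → Set (EuclideanSpace ℝ (Fin d))}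
    (hY : IsPoissonPointProcess P' Y (lam * (1 + ε))) :
    coloringConstant k (lam * (1 + ε)) P' Y ≤ coloringConstant k lam P X + ε := by
  have hratio (t : ℝ) (ht : 0 < t) : meanColoringRatio k (lam * (1 + ε)) P' Y t ≤
      meanColoringRatio k lam P X t + ENNReal.ofReal ε := by
    have hpos : 0 < lam * t ^ d := by positivity
    have hmean := hX.lintegral_maxColored_le_add (s := lam * ε) hlam.le (by positivity)
      (by rwa [mul_add, mul_one] at hY) k 1 (measurableSet_cube d t) (isBounded_cube d t)
    rw [volume_real_cube d ht.le] at hmean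
    calc meanColoringRatio k (lam * (1 + ε)) P' Y t
        ≤ (∫⁻ ω, (coloredCount k Y t ω : ℝ≥0∞) ∂P') / ENNReal.ofReal (lam * t ^ d) :=
          ENNReal.div_le_div_left (ENNReal.ofReal_le_ofReal (by gcongr; nlinarith)) _
      _ ≤ (∫⁻ ω, (coloredCount k X t ω : ℝ≥0∞) ∂P + ENNReal.ofReal (lam * ε * t ^ d)) /
            ENNReal.ofReal (lam * t ^ d) := ENNReal.div_le_div_right hmean _
      _ = meanColoringRatio k lam P X t + ENNReal.ofReal ε := by
          rw [ENNReal.add_div, ← ENNReal.ofReal_div_of_pos hpos, meanColoringRatio]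
          congr 2
          field_simp
  -- The ratio at `t = 1` is already finite, so `toReal` loses nothing on the right-hand side.
  have hfin : (⨅ (t : ℝ) (_ : 0 < t), meanColoringRatio k lam P X t) ≠ ∞ := by
    refine ((iInf₂_le (1 : ℝ) one_pos).trans_lt ?_).ne
    refine ENNReal.div_lt_top (ne_top_of_le_ne_top ENNReal.ofReal_ne_top
      (hX.lintegral_maxColored_le_mul_volume k 1 (measurableSet_cube d 1) (isBounded_cube d 1))) ?_
    simpa using hlam
  rw [coloringConstant, coloringConstant, ← ENNReal.toReal_ofReal hε.le,
    ← ENNReal.toReal_add hfin ENNReal.ofReal_ne_top, ENNReal.toReal_ofReal hε.le]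
  refine ENNReal.toReal_mono (ENNReal.add_ne_top.2 ⟨hfin, ENNReal.ofReal_ne_top⟩) ?_
  simp only [ENNReal.iInf_add]
  exact iInf₂_mono hratio

theorem proposition2 (d k : ℕ) (hd : 1 ≤ d) (hk : 1 ≤ k) (lam ε : ℝ) (hlam : 0 < lam) (hε : 0 < ε)
    {Ω : Type*} [MeasurableSpace Ω] (P : Measure Ω) [IsProbabilityMeasure P]
    (X : Ω → Set (EuclideanSpace ℝ (Fin d))) (hX : IsPoissonPointProcess P X lam)
    {Ω' : Type*} [MeasurableSpace Ω'] (P' : Measure Ω') [IsProbabilityMeasure P']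
    (Y : Ω' → Set (EuclideanSpace ℝ (Fin d))) :
    (IsPoissonPointProcess P' Y (lam * (1 + ε)) →
      coloringConstant k (lam * (1 + ε)) P' Y ≤ coloringConstant k lam P X + ε) ∧
    (ε < 1 → IsPoissonPointProcess P' Y (lam * (1 - ε)) →
      coloringConstant k (lam * (1 - ε)) P' Y ≥ coloringConstant k lam P X - ε / (1 - ε)) := by
  refine ⟨coloringConstant_le_add hlam hε hX, fun hε1 hY => ?_⟩
  have h1 : 0 < 1 - ε := sub_pos.2 hε1
  -- The second bound is the first one started from `lam * (1 - ε)`: the relative increase back to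
  -- `lam` is `ε / (1 - ε)`.
  have hmul : lam * (1 - ε) * (1 + ε / (1 - ε)) = lam := by
    field_simp
    ring
  have h := coloringConstant_le_add (k := k) (mul_pos hlam h1) (div_pos hε h1) hY
    (by rwa [hmul] : IsPoissonPointProcess P X (lam * (1 - ε) * (1 + ε / (1 - ε))))
  rw [hmul] at h
  linarith
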